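/- There is a constant $C$ such that for every integer $k\ge 0$ (with $0^0=1$), every finite simple graph $G$ with average degree at least $k^{Ck^6}$ contains a bipartite subgraph $H$ (not necessarily induced) that has at least one vertex, is $C_4$-free, and has average degree at least $k$. Here the average degree of a graph $G$ is $d(G) = 2|E(G)|/|V(G)|$, and a graph is $C_4$-free if it has no subgraph (induced or not) isomorphic to the $4$-cycle $C_4$. -/

import Mathlib

/-- The average degree `d(G) = 2 e(G) / |G|` of a finite graph `G`. -/
noncomputable def SimpleGraph.avgDegree {V : Type*} [Finite V] (G : SimpleGraph V) : ℝ :=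
  2 * (G.edgeSet.ncard : ℝ) / (Nat.card V : ℝ)

/-! Pass to a subgraph `S` of maximal average degree `D`, and let `L` be its vertices of degree
above `K * D`; then `L` has at most `#S / K` vertices. There are two cases.

If `S \ L` keeps a quarter of the degree sum, its maximum degree is at most a constant times its
density. Take a bipartite cut with half the edges and in it a maximal `C₄`-free subgraph of degrees
at most `q`. Each rejected edge meets a saturated vertex or closes a path of three chosen edges, so
few edges are rejected per chosen one (`exists_C4Free_subset`).

Otherwise many edges join `L` to `S \ L`. Let `B` be the vertices of `S \ L` with many neighbours in
`L`. Since `L ∪ B` is no denser than `S`, it is large, so `B` is much larger than `L`. Then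
`exists_linear_subfamily_or_common_points` applies. Either many neighbourhoods of vertices of `B`
shrink to `k`-sets meeting pairwise in at most one point, which is `C₄`-freeness, or `L` and `B`
span a `K_{p², p²}` with `p ≥ k` prime, which contains the incidence graph of an affine plane. -/

section

open Finset
open scoped Classical

/-! ### Set systems: linear subsystems or many common points -/

/-- Greedy bound for independent sets in a relation with bounded degrees. -/
theorem Finset.exists_pairwise_not_of_card_le {α : Type*} (R : α → α → Prop)
    (hR : ∀ x y, R x y → R y x) (W : Finset α) (D : ℕ)
    (hD : ∀ w ∈ W, #{v ∈ W | R w v} ≤ D) :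
    ∃ I ⊆ W, (∀ x ∈ I, ∀ y ∈ I, x ≠ y → ¬ R x y) ∧ #W ≤ #I * (D + 1) := by
  obtain ⟨I, hI, hmax⟩ := exists_max_image
    (W.powerset.filter fun I => ∀ x ∈ I, ∀ y ∈ I, x ≠ y → ¬ R x y) card
    ⟨∅, by simp⟩
  simp only [mem_filter, mem_powerset] at hI hmax
  refine ⟨I, hI.1, hI.2, ?_⟩
  have hcover : W ⊆ I.biUnion fun x => insert x {v ∈ W | R x v} := by
    intro w hw
    by_contra hcon
    simp only [mem_biUnion, mem_insert, mem_filter, not_exists, not_and, not_or] at hcon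
    have hwI : w ∉ I := fun h => (hcon w h).1 rfl
    have := hmax (insert w I) ⟨insert_subset hw hI.1, by
      intro x hx y hy hxy hRxy
      rcases mem_insert.1 hx with hx | hx <;> rcases mem_insert.1 hy with hy | hy
      · exact hxy (hx.trans hy.symm)
      · exact (hcon y hy).2 hw (hR _ _ (hx ▸ hRxy))
      · exact (hcon x hx).2 hw (hy ▸ hRxy)
      · exact hI.2 x hx y hy hxy hRxy⟩
    rw [card_insert_of_notMem hwI] at this
    omega
  exact (card_le_card hcover).trans <| card_biUnion_le_card_mul _ _ _ fun x hx =>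
    (card_insert_le _ _).trans <| Nat.succ_le_succ (hD x (hI.1 hx))

/-- A uniform set system with bounded codegrees contains a large linear subsystem. -/
theorem Finset.exists_linear_subfamily {α β : Type*} (B : Finset β) (I : β → Finset α) (k T : ℕ)
    (hI : ∀ b ∈ B, #(I b) = k)
    (hT : ∀ b ∈ B, ∀ x ∈ I b, ∀ y ∈ I b, x ≠ y → #{b' ∈ B | x ∈ I b' ∧ y ∈ I b'} ≤ T) :
    ∃ B' ⊆ B, (∀ b ∈ B', ∀ b' ∈ B', b ≠ b' → #(I b ∩ I b') ≤ 1) ∧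
      #B ≤ #B' * (k * k * T + 1) := by
  obtain ⟨R, hR⟩ : ∃ R : β → β → Prop, ∀ b b', R b b' ↔ 1 < #(I b ∩ I b') :=
    ⟨_, fun _ _ => Iff.rfl⟩
  obtain ⟨B', hB', hlin, hcard⟩ := exists_pairwise_not_of_card_le
    R (fun x y h => by rwa [hR, inter_comm, ← hR]) B (k * k * T) (by
      intro b hb
      have hsub : ∀ v ∈ B, R b v → v ∈
          ((I b ×ˢ I b).filter fun p => p.1 ≠ p.2).biUnion
            fun p => {b' ∈ B | p.1 ∈ I b' ∧ p.2 ∈ I b'} := by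
        intro v hv hvb
        obtain ⟨x, y, hx, hy, hxy⟩ := one_lt_card_iff.1 ((hR _ _).1 hvb)
        rw [mem_inter] at hx hy
        exact mem_biUnion.2 ⟨(x, y), by simp [hx, hy, hxy], by simp [hx, hy, hv]⟩
      refine (card_le_card fun v hv => hsub v (mem_filter.1 hv).1 (mem_filter.1 hv).2).trans
        ((card_biUnion_le_card_mul _ _ T ?_).trans ?_)
      · rintro ⟨x, y⟩ hp
        simp only [mem_filter, mem_product] at hp
        exact hT b hb x hp.1.1 y hp.1.2 hp.2
      · refine Nat.mul_le_mul_right _ ((card_filter_le _ _).trans ?_)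
        rw [card_product, hI b hb])
  exact ⟨B', hB', fun b hb b' hb' h => not_lt.1 fun h1 => hlin b hb b' hb' h ((hR _ _).2 h1), hcard⟩

/-- Averaging over the possible first vertices `a` of a heavy pair. -/
theorem Finset.exists_heavy_vertex {α β : Type*} (A : Finset α) (B B' : Finset β)
    (N : β → Finset α) (H : α → α → Prop) (r r₁ T : ℕ)
    (hA : ∀ b ∈ B, N b ⊆ A) (hN : ∀ b ∈ B, #(N b) = r)
    (hH : ∀ x y, H x y → T ≤ #{b ∈ B | x ∈ N b ∧ y ∈ N b})
    (hBB : B' ⊆ B) (hne : B'.Nonempty) (hcard : #B ≤ 2 * #B')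
    (hex : ∀ b ∈ B', ∃ a ∈ N b, r₁ ≤ #{y ∈ N b | H a y}) :
    ∃ a ∈ A, ({b ∈ B' | a ∈ N b ∧ r₁ ≤ #{y ∈ N b | H a y}} : Finset β).Nonempty ∧
      T * #{y ∈ A | H a y} ≤
        2 * r ^ 2 * #{b ∈ B' | a ∈ N b ∧ r₁ ≤ #{y ∈ N b | H a y}} := by
  by_contra! hcon
  set B₁ : α → Finset β := fun a => {b ∈ B' | a ∈ N b ∧ r₁ ≤ #{y ∈ N b | H a y}} with hB₁
  have hcover : B' ⊆ A.biUnion B₁ := by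
    intro b hb
    obtain ⟨a, ha, har⟩ := hex b hb
    exact mem_biUnion.2 ⟨a, hA b (hBB hb) ha, by simp [hB₁, hb, ha, har]⟩
  -- Empty classes satisfy this trivially, so the sum is strict only at a nonempty one. This is why
  -- nonemptiness can be part of the conclusion.
  have hle : ∀ a ∈ A, 2 * r ^ 2 * #(B₁ a) ≤ T * #{y ∈ A | H a y} := by
    intro a ha
    rcases (B₁ a).eq_empty_or_nonempty with h | h
    · simp [h]
    · exact (hcon a ha h).le
  obtain ⟨b, hb⟩ := hne
  obtain ⟨a, ha, hab⟩ := mem_biUnion.1 (hcover hb)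
  have hlt : ∑ a ∈ A, 2 * r ^ 2 * #(B₁ a) < ∑ a ∈ A, T * #{y ∈ A | H a y} :=
    sum_lt_sum hle ⟨a, ha, hcon a ha ⟨b, hab⟩⟩
  have h1 : #B' ≤ ∑ a ∈ A, #(B₁ a) := (card_le_card hcover).trans card_biUnion_le
  have h2 : ∑ a ∈ A, T * #{y ∈ A | H a y} ≤
      ∑ a ∈ A, ∑ y ∈ A, #{b ∈ B | a ∈ N b ∧ y ∈ N b} := by
    refine sum_le_sum fun a _ => ?_
    calc T * #{y ∈ A | H a y} = ∑ y ∈ A with H a y, T := by simp [mul_comm]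
      _ ≤ ∑ y ∈ A with H a y, #{b ∈ B | a ∈ N b ∧ y ∈ N b} :=
        sum_le_sum fun y hy => hH a y (mem_filter.1 hy).2
      _ ≤ _ := sum_le_sum_of_subset (filter_subset _ _)
  have h3 : ∑ a ∈ A, ∑ y ∈ A, #{b ∈ B | a ∈ N b ∧ y ∈ N b} ≤ #B * r ^ 2 := by
    have : ∑ a ∈ A, ∑ y ∈ A, #{b ∈ B | a ∈ N b ∧ y ∈ N b} =
        ∑ b ∈ B, #{p ∈ A ×ˢ A | p.1 ∈ N b ∧ p.2 ∈ N b} := by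
      simp only [card_filter]
      rw [← sum_product', sum_comm]
    rw [this, ← smul_eq_mul]
    refine sum_le_card_nsmul _ _ _ fun b hb => ?_
    calc #{p ∈ A ×ˢ A | p.1 ∈ N b ∧ p.2 ∈ N b} ≤ #(N b ×ˢ N b) :=
          card_le_card fun p hp => by simpa using (mem_filter.1 hp).2
      _ = r ^ 2 := by rw [card_product, hN b hb, sq]
  rw [← mul_sum] at hlt
  have h4 : #B * r ^ 2 ≤ 2 * #B' * r ^ 2 := Nat.mul_le_mul_right _ hcard
  have h5 : 2 * r ^ 2 * #B' ≤ 2 * r ^ 2 * ∑ a ∈ A, #(B₁ a) := Nat.mul_le_mul_left _ h1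
  have h6 : 2 * r ^ 2 * #B' = 2 * #B' * r ^ 2 := by ring
  omega

/-- The imbalance needed to find `j` points in the intersection of `s` members
of a set system that has no large linear `k`-uniform trimming. -/
def imbalance (k s : ℕ) : ℕ → ℕ
  | 0 => s
  | j + 1 => 6 * k ^ (2 * j + 4) * imbalance k s j

theorem imbalance_pos {k s : ℕ} (hk : 0 < k) (hs : 0 < s) : ∀ j, 0 < imbalance k s j
  | 0 => hs
  | j + 1 => by
    have := imbalance_pos hk hs j
    simp only [imbalance]
    positivity

/-- Call a pair of points heavy if many sets contain it. If half of the sets have a `k`-subset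
without heavy pairs, bounded codegrees give a linear subsystem. If not, in half of the sets some
point lies in many heavy pairs; averaging fixes one such point `a`, and the induction continues
among its heavy partners, with `a` as a new common point. -/
theorem exists_linear_subfamily_or_common_points {α β : Type*} {k s : ℕ} (hk : 0 < k)
    (hs : 0 < s) (j : ℕ) (A : Finset α) (B : Finset β) (N : β → Finset α) (hne : B.Nonempty)
    (hA : ∀ b ∈ B, N b ⊆ A) (hN : ∀ b ∈ B, k ^ j ≤ #(N b))
    (hM : imbalance k s j * #A ≤ #B) :
    (∃ A' ⊆ A, ∃ B' ⊆ B, ∃ N' : β → Finset α, B'.Nonempty ∧ #A' ≤ #B' ∧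
      (∀ b ∈ B', N' b ⊆ A' ∧ N' b ⊆ N b ∧ #(N' b) = k) ∧
      ∀ b ∈ B', ∀ b' ∈ B', b ≠ b' → #(N' b ∩ N' b') ≤ 1) ∨
    ∃ C ⊆ A, #C = j ∧ ∃ B' ⊆ B, s ≤ #B' ∧ ∀ b ∈ B', C ⊆ N b := by
  induction j generalizing A B N with
  | zero =>
    refine Or.inr ⟨∅, by simp, rfl, B, Subset.rfl, ?_, by simp⟩
    -- Some `N b` has at least `k ^ 0 = 1` point, so `A` is nonempty and `#B ≥ s`.
    obtain ⟨b, hb⟩ := hne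
    have h1 := hN b hb
    have h2 := card_le_card (hA b hb)
    simp only [imbalance, pow_zero] at *
    nlinarith
  | succ j ih =>
    have htrim : ∀ b, ∃ S, S ⊆ N b ∧ (b ∈ B → #S = k ^ (j + 1)) := by
      intro b
      by_cases hb : b ∈ B
      · obtain ⟨S, h1, h2⟩ := exists_subset_card_eq (hN b hb)
        exact ⟨S, h1, fun _ => h2⟩
      · exact ⟨∅, by simp, fun h => absurd h hb⟩
    choose N₀ hN₀ hN₀card using htrim
    set r := k ^ (j + 1) with hr
    set M := imbalance k s j with hMdef
    have hMpos : 0 < M := imbalance_pos hk hs j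
    have hrpos : 0 < r := by positivity
    -- `exists_heavy_vertex` gives the ratio `T / (2 * r ^ 2)`, which has to be the imbalance `M` of
    -- the next step.
    set T := 2 * r ^ 2 * M with hT
    obtain ⟨H, hH⟩ : ∃ H : α → α → Prop, ∀ x y, H x y ↔
        x ≠ y ∧ T ≤ #{b ∈ B | x ∈ N₀ b ∧ y ∈ N₀ b} := ⟨_, fun _ _ => Iff.rfl⟩
    have hHsymm : ∀ x y, H x y → H y x := by
      intro x y h
      rw [hH] at h ⊢
      refine ⟨h.1.symm, h.2.trans_eq ?_⟩
      simp only [and_comm]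
    obtain ⟨P, hP⟩ : ∃ P : β → Prop, ∀ b, P b ↔
        ∃ I ⊆ N₀ b, #I = k ∧ ∀ x ∈ I, ∀ y ∈ I, x ≠ y → ¬ H x y := ⟨_, fun _ => Iff.rfl⟩
    have hsplit : #{b ∈ B | P b} + #{b ∈ B | ¬ P b} = #B := by
      convert card_filter_add_card_filter_not (s := B) P
    rcases le_or_gt #B (2 * #{b ∈ B | P b}) with hlight | hheavy
    · left
      have hI : ∀ b, ∃ I ⊆ N₀ b, P b → #I = k ∧ ∀ x ∈ I, ∀ y ∈ I, x ≠ y → ¬ H x y := by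
        intro b
        by_cases hb : P b
        · obtain ⟨I, h1, h2⟩ := (hP b).1 hb
          exact ⟨I, h1, fun _ => h2⟩
        · exact ⟨∅, by simp, fun h => absurd h hb⟩
      choose I hIN hI using hI
      obtain ⟨B', hB', hlin, hcard⟩ := exists_linear_subfamily {b ∈ B | P b} I k T
        (fun b hb => (hI b (mem_filter.1 hb).2).1) (by
          intro b hb x hx y hy hxy
          have := (hI b (mem_filter.1 hb).2).2 x hx y hy hxy
          simp only [hH, not_and, not_le] at this
          refine le_trans (card_le_card ?_) (this hxy).le
          intro b' hb'
          simp only [mem_filter] at hb' ⊢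
          exact ⟨hb'.1.1, hIN _ hb'.2.1, hIN _ hb'.2.2⟩)
      have hBB : B' ⊆ B := hB'.trans (filter_subset _ _)
      have hBpos : 0 < #B := hne.card_pos
      refine ⟨A, Subset.rfl, B', hBB, I, ?_, ?_, ?_, hlin⟩
      · rw [← card_pos]
        by_contra h0
        have : #B' = 0 := by omega
        rw [this] at hcard
        omega
      · have hcoef : 2 * (k * k * T + 1) ≤ imbalance k s (j + 1) := by
          have e1 : imbalance k s (j + 1) = 6 * (k * k * r ^ 2 * M) := by
            simp only [imbalance, hr]; ring
          have e2 : k * k * T = 2 * (k * k * r ^ 2 * M) := by rw [hT]; ring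
          have : 0 < k * k * r ^ 2 * M := by positivity
          omega
        have h1 : 2 * (k * k * T + 1) * #A ≤ 2 * (k * k * T + 1) * #B' :=
          calc _ ≤ _ := Nat.mul_le_mul_right _ hcoef
            _ ≤ _ := hM
            _ ≤ _ := hlight
            _ ≤ 2 * (#B' * (k * k * T + 1)) := Nat.mul_le_mul_left _ hcard
            _ = _ := by ring
        exact Nat.le_of_mul_le_mul_left h1 (by positivity)
      · intro b hb
        exact ⟨(hIN b).trans ((hN₀ b).trans (hA b (hBB hb))), (hIN b).trans (hN₀ b),
          (hI b (mem_filter.1 (hB' hb)).2).1⟩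
    · have hnP : #B ≤ 2 * #{b ∈ B | ¬ P b} := by omega
      obtain ⟨a, haA, hB₁ne, hratio⟩ := exists_heavy_vertex A B {b ∈ B | ¬ P b} N₀ H r (k ^ j) T
        (fun b hb => (hN₀ b).trans (hA b hb)) hN₀card (fun x y h => ((hH x y).1 h).2)
        (filter_subset _ _) (card_pos.1 (by have := hne.card_pos; omega)) hnP (by
          intro b hb
          obtain ⟨hbB, hbP⟩ := mem_filter.1 hb
          by_contra! hcon
          have hkj : 0 < k ^ j := by positivity
          -- If every point had fewer than `k ^ j` heavy partners, the greedy bound would give `k ^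
          -- (j + 1) / k ^ j = k` points without a heavy pair.
          obtain ⟨I, hIN, hI, hcard⟩ := exists_pairwise_not_of_card_le H hHsymm (N₀ b) (k ^ j - 1)
            fun w hw => by have := hcon w hw; omega
          rw [Nat.sub_add_cancel hkj, hN₀card b hbB, hr, pow_succ'] at hcard
          obtain ⟨I', hI', hI'card⟩ := exists_subset_card_eq (Nat.le_of_mul_le_mul_right hcard hkj)
          exact hbP <| (hP b).2 ⟨I', hI'.trans hIN, hI'card, fun x hx y hy => hI x (hI' hx) y (hI' hy)⟩)
      set B₁ : Finset β := {b ∈ ({b ∈ B | ¬ P b} : Finset β) |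
        a ∈ N₀ b ∧ k ^ j ≤ #{y ∈ N₀ b | H a y}} with hB₁
      have hB₁B : B₁ ⊆ B := (filter_subset _ _).trans (filter_subset _ _)
      have hMle : M * #{y ∈ A | H a y} ≤ #B₁ := by
        refine le_of_mul_le_mul_left (a := 2 * r ^ 2) ?_ (by positivity)
        rwa [← mul_assoc]
      rcases ih {y ∈ A | H a y} B₁ (fun b => {y ∈ N₀ b | H a y}) hB₁ne
        (fun b hb => filter_subset_filter _ ((hN₀ b).trans (hA b (hB₁B hb))))
        (fun b hb => (mem_filter.1 hb).2.2) hMle with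
        ⟨A', hA', B', hB', N', h1, h2, h3, h4⟩ | ⟨C, hC, hCcard, B', hB', hs', hCB⟩
      · exact Or.inl ⟨A', hA'.trans (filter_subset _ _), B', hB'.trans hB₁B, N', h1, h2,
          fun b hb => ⟨(h3 b hb).1, (h3 b hb).2.1.trans ((filter_subset _ _).trans (hN₀ b)),
            (h3 b hb).2.2⟩, h4⟩
      · refine Or.inr ⟨insert a C, insert_subset haA (hC.trans (filter_subset _ _)), ?_, B',
          hB'.trans hB₁B, hs', ?_⟩
        · rw [card_insert_of_notMem, hCcard]
          intro h
          exact ((hH a a).1 (mem_filter.1 (hC h)).2).1 rfl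
        · intro b hb
          exact insert_subset (hN₀ b (mem_filter.1 (hB' hb)).2.1)
            ((hCB b hb).trans ((filter_subset _ _).trans (hN₀ b)))

/-! ### `C₄`-free bipartite subgraphs from linear systems and from affine planes -/

/-- `G` has a nonempty bipartite `C₄`-free subgraph of average degree at least `k`, given by its
two sides and its set of oriented edges. -/
def SimpleGraph.HasC4FreeBipartite {V : Type*} (G : SimpleGraph V) (k : ℕ) : Prop :=
  ∃ (A B : Finset V) (F : Finset (V × V)), (A ∪ B).Nonempty ∧ Disjoint A B ∧
    (∀ a b, (a, b) ∈ F → a ∈ A ∧ b ∈ B ∧ G.Adj a b) ∧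
    (∀ a a' b b', (a, b) ∈ F → (a, b') ∈ F → (a', b) ∈ F → (a', b') ∈ F → a = a' ∨ b = b') ∧
    k * (#A + #B) ≤ 2 * #F

theorem SimpleGraph.HasC4FreeBipartite.exists_subgraph {V : Type*} [Finite V] {G : SimpleGraph V}
    {k : ℕ} (h : G.HasC4FreeBipartite k) :
    ∃ H : G.Subgraph, H.verts.Nonempty ∧ H.coe.IsBipartite ∧
      (SimpleGraph.cycleGraph 4).Free H.coe ∧ (k : ℝ) ≤ H.coe.avgDegree := by
  obtain ⟨A, B, F, hne, hdisj, hF, hC4, hcard⟩ := h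
  let H : G.Subgraph :=
    { verts := (A ∪ B : Finset V)
      Adj := fun x y => (x, y) ∈ F ∨ (y, x) ∈ F
      adj_sub := by
        rintro x y (h | h)
        · exact (hF _ _ h).2.2
        · exact (hF _ _ h).2.2.symm
      edge_vert := by
        rintro x y (h | h)
        · simp [(hF _ _ h).1]
        · simp [(hF _ _ h).2.1]
      symm := ⟨fun x y h => h.symm⟩ }
  have hAB : ∀ x, x ∈ A → x ∉ B := fun x hx hx' => Finset.disjoint_left.1 hdisj hx hx'
  have hA : ∀ x y, H.Adj x y → x ∈ A → (x, y) ∈ F := by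
    rintro x y (h | h) hx
    · exact h
    · exact absurd (hF _ _ h).2.1 (hAB x hx)
  have hB : ∀ x y, H.Adj x y → x ∉ A → (y, x) ∈ F := by
    rintro x y (h | h) hx
    · exact absurd (hF _ _ h).1 hx
    · exact h
  refine ⟨H, by simpa [H] using hne, ⟨SimpleGraph.Coloring.mk
    (fun x => if (x : V) ∈ A then (0 : Fin 2) else 1) ?_⟩, ?_, ?_⟩
  · rintro ⟨x, hx⟩ ⟨y, hy⟩ hxy
    rw [SimpleGraph.Subgraph.coe_adj] at hxy
    by_cases hxA : x ∈ A
    · have : y ∉ A := fun h => hAB y h (hF _ _ (hA x y hxy hxA)).2.1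
      simp [hxA, this]
    · simp [hxA, (hF _ _ (hB x y hxy hxA)).1]
  · rintro ⟨f⟩
    have hadj : ∀ i j, (SimpleGraph.cycleGraph 4).Adj i j → H.Adj (f i) (f j) :=
      fun i j hij => f.toHom.map_adj hij
    have hinj : ∀ i j, ((f i : H.verts) : V) = f j → i = j :=
      fun i j hij => f.injective (Subtype.ext hij)
    have h01 := hadj 0 1 (by decide)
    have h21 := hadj 2 1 (by decide)
    have h03 := hadj 0 3 (by decide)
    have h23 := hadj 2 3 (by decide)
    by_cases h0 : ((f 0 : H.verts) : V) ∈ A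
    · have h1 := hA _ _ h01 h0
      have h2 := hB _ _ h21.symm fun h => hAB _ h (hF _ _ h1).2.1
      have h3 := hA _ _ h03 h0
      have h4 := hA _ _ h23 (hF _ _ h2).1
      rcases hC4 _ _ _ _ h1 h3 h2 h4 with h | h
      · exact absurd (hinj _ _ h) (by decide)
      · exact absurd (hinj _ _ h) (by decide)
    · have h1 := hB _ _ h01 h0
      have h2 := hA _ _ h21.symm (hF _ _ h1).1
      have h3 := hB _ _ h03 h0
      have h4 := hA _ _ h23.symm (hF _ _ h3).1
      rcases hC4 _ _ _ _ h1 h2 h3 h4 with h | h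
      · exact absurd (hinj _ _ h) (by decide)
      · exact absurd (hinj _ _ h) (by decide)
  · have hV : Nat.card H.verts = #A + #B := by
      rw [← card_union_of_disjoint hdisj]
      simp [H]
    have hVpos : 0 < #A + #B := by
      rw [← card_union_of_disjoint hdisj]; exact hne.card_pos
    have hE : #F ≤ H.coe.edgeSet.ncard := by
      have hmem : ∀ p ∈ F, p.1 ∈ H.verts ∧ p.2 ∈ H.verts := fun p hp =>
        ⟨by simp [H, (hF p.1 p.2 hp).1], by simp [H, (hF p.1 p.2 hp).2.1]⟩
      rw [← F.card_attach, ← Set.ncard_coe_finset]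
      refine Set.ncard_le_ncard_of_injOn
        (fun p => s(⟨p.1.1, (hmem _ p.2).1⟩, ⟨p.1.2, (hmem _ p.2).2⟩)) ?_ ?_ (Set.toFinite _)
      · rintro ⟨⟨x, y⟩, hp⟩ -
        exact Or.inl hp
      · rintro ⟨⟨x, y⟩, hp⟩ - ⟨⟨x', y'⟩, hp'⟩ - h
        simp only [Sym2.eq_iff, Subtype.mk.injEq] at h
        rcases h with ⟨rfl, rfl⟩ | ⟨rfl, rfl⟩
        · rfl
        · exact absurd (hF _ _ hp').2.1 (hAB _ (hF _ _ hp).1)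
    rw [SimpleGraph.avgDegree, hV, le_div_iff₀ (by exact_mod_cast hVpos)]
    exact_mod_cast hcard.trans (Nat.mul_le_mul_left 2 hE)

/-- A `C₄` is a pair of sets sharing two points. There are `k * #B` edges on at most `2 * #B`
vertices. -/
theorem SimpleGraph.hasC4FreeBipartite_of_linear {V : Type*} {G : SimpleGraph V} {k : ℕ}
    {A B : Finset V} (N : V → Finset V) (hdisj : Disjoint A B) (hB : B.Nonempty)
    (hcard : #A ≤ #B) (hN : ∀ b ∈ B, N b ⊆ A ∧ #(N b) = k)
    (hadj : ∀ b ∈ B, ∀ a ∈ N b, G.Adj a b)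
    (hlin : ∀ b ∈ B, ∀ b' ∈ B, b ≠ b' → #(N b ∩ N b') ≤ 1) : G.HasC4FreeBipartite k := by
  refine ⟨A, B, {p ∈ A ×ˢ B | p.1 ∈ N p.2}, hB.mono subset_union_right, hdisj, ?_, ?_, ?_⟩
  · intro a b h
    simp only [mem_filter, mem_product] at h
    exact ⟨h.1.1, h.1.2, hadj b h.1.2 a h.2⟩
  · intro a a' b b' h1 h2 h3 h4
    simp only [mem_filter, mem_product] at h1 h2 h3 h4
    by_contra! hne
    have := hlin b h1.1.2 b' h2.1.2 hne.2
    exact hne.1 (card_le_one.1 this a (mem_inter.2 ⟨h1.2, h2.2⟩) a' (mem_inter.2 ⟨h3.2, h4.2⟩))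
  · have : #{p ∈ A ×ˢ B | p.1 ∈ N p.2} = k * #B := by
      rw [card_filter, sum_product_right, mul_comm, ← smul_eq_mul, ← sum_const]
      refine sum_congr rfl fun b hb => ?_
      have : {a ∈ A | a ∈ N b} = N b := by
        rw [filter_mem_eq_inter, inter_eq_right.2 (hN b hb).1]
      rw [← card_filter]
      exact (congrArg card this).trans (hN b hb).2
    rw [this]
    nlinarith

/-- The incidence graph of the affine plane over `ZMod p` sits inside `K_{p², p²}`. -/
theorem SimpleGraph.hasC4FreeBipartite_of_complete {V : Type*} {G : SimpleGraph V} {k p : ℕ}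
    [Fact p.Prime] (hkp : k ≤ p) {A B : Finset V} (hdisj : Disjoint A B) (hA : #A = p ^ 2)
    (hB : #B = p ^ 2) (hadj : ∀ a ∈ A, ∀ b ∈ B, G.Adj a b) : G.HasC4FreeBipartite k := by
  have hppos : 0 < p := (Fact.out : p.Prime).pos
  have hc : Fintype.card (ZMod p × ZMod p) = p ^ 2 := by
    rw [Fintype.card_prod, ZMod.card, sq]
  have e : ZMod p × ZMod p ≃ A := Fintype.equivOfCardEq (by simp [hc, hA])
  have e' : ZMod p × ZMod p ≃ B := Fintype.equivOfCardEq (by simp [hc, hB])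
  -- The triple `(x, m, t)` is the incidence of the point `(x, m * x + t)` with the line `(m, t)`,
  -- so there are `p ^ 3` edges.
  let φ : ZMod p × ZMod p × ZMod p → V × V := fun q =>
    (e (q.1, q.2.1 * q.1 + q.2.2), e' (q.2.1, q.2.2))
  have hφ : Function.Injective φ := by
    rintro ⟨x, m, t⟩ ⟨x', m', t'⟩ h
    simp only [φ, Prod.mk.injEq, SetLike.coe_eq_coe, EmbeddingLike.apply_eq_iff_eq] at h
    simp [h]
  have hmem : ∀ a b, (a, b) ∈ univ.image φ → ∃ (P L : ZMod p × ZMod p),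
      a = e P ∧ b = e' L ∧ P.2 = L.1 * P.1 + L.2 := by
    intro a b h
    obtain ⟨⟨x, m, t⟩, -, h⟩ := mem_image.1 h
    simp only [φ, Prod.mk.injEq] at h
    exact ⟨_, _, h.1.symm, h.2.symm, rfl⟩
  refine ⟨A, B, univ.image φ, ?_, hdisj, ?_, ?_, ?_⟩
  · refine (card_pos.1 ?_).mono subset_union_left
    rw [hA]; positivity
  · intro a b h
    obtain ⟨P, L, rfl, rfl, -⟩ := hmem a b h
    exact ⟨(e P).2, (e' L).2, hadj _ (e P).2 _ (e' L).2⟩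
  · intro a a' b b' h1 h2 h3 h4
    obtain ⟨P, L, rfl, rfl, hPL⟩ := hmem _ _ h1
    obtain ⟨P₁, L', hP₁, rfl, hPL'⟩ := hmem _ _ h2
    obtain ⟨P', L₁, rfl, hL₁, hP'L⟩ := hmem _ _ h3
    obtain ⟨P₂, L₂, hP₂, hL₂, hP'L'⟩ := hmem _ _ h4
    simp only [SetLike.coe_eq_coe, EmbeddingLike.apply_eq_iff_eq] at hP₁ hL₁ hP₂ hL₂ ⊢
    subst hP₁ hL₁ hP₂ hL₂
    have key : (L.1 - L'.1) * (P.1 - P'.1) = 0 := by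
      linear_combination (-1 : ZMod p) * hPL + hPL' + hP'L - hP'L'
    rcases mul_eq_zero.1 key with h | h
    · right
      have h := sub_eq_zero.1 h
      refine Prod.ext h ?_
      rw [h] at hPL
      linear_combination hPL' - hPL
    · left
      have h := sub_eq_zero.1 h
      refine Prod.ext h ?_
      rw [hPL, hP'L, h]
  · rw [card_image_of_injective _ hφ, card_univ, Fintype.card_prod, hc, ZMod.card, hA, hB]
    nlinarith [Nat.mul_le_mul_right (p ^ 2) hkp]

theorem SimpleGraph.hasC4FreeBipartite_of_imbalance {V : Type*} {G : SimpleGraph V} {k p : ℕ}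
    [Fact p.Prime] (hk : 0 < k) (hkp : k ≤ p) {A B : Finset V} (hdisj : Disjoint A B)
    (hne : B.Nonempty) (hdeg : ∀ b ∈ B, k ^ p ^ 2 ≤ #{a ∈ A | G.Adj a b})
    (hcard : imbalance k (p ^ 2) (p ^ 2) * #A ≤ #B) : G.HasC4FreeBipartite k := by
  have hppos : 0 < p := (Fact.out : p.Prime).pos
  rcases exists_linear_subfamily_or_common_points hk (by positivity : 0 < p ^ 2) (p ^ 2) A B
    (fun b => {a ∈ A | G.Adj a b}) hne (fun b _ => filter_subset _ _) hdeg hcard with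
    ⟨A', hA', B', hB', N, hne', hcard', hN, hlin⟩ | ⟨C, hC, hCcard, B', hB', hs, hCB⟩
  · exact hasC4FreeBipartite_of_linear N (disjoint_of_subset_left hA'
      (disjoint_of_subset_right hB' hdisj)) hne' hcard' (fun b hb => ⟨(hN b hb).1, (hN b hb).2.2⟩)
      (fun b hb a ha => (mem_filter.1 ((hN b hb).2.1 ha)).2) hlin
  · obtain ⟨B'', hB'', hcard''⟩ := exists_subset_card_eq hs
    exact hasC4FreeBipartite_of_complete hkp (disjoint_of_subset_left hC
      (disjoint_of_subset_right (hB''.trans hB') hdisj)) hCcard hcard''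
      fun a ha b hb => (mem_filter.1 (hCB b (hB'' hb) ha)).2

/-! ### Maximal `C₄`-free subgraphs under a degree bound -/

/-- A bipartite graph, given by its set of edges, with bounded degrees has a large `C₄`-free
subgraph: take a maximal one among those with degrees at most `q`. -/
theorem Finset.exists_C4Free_subset {α β : Type*} (E : Finset (α × β)) (Δ q : ℕ)
    (h₁ : ∀ x, #{p ∈ E | p.1 = x} ≤ Δ) (h₂ : ∀ y, #{p ∈ E | p.2 = y} ≤ Δ) :
    ∃ F ⊆ E, (∀ a a' b b', (a, b) ∈ F → (a, b') ∈ F → (a', b) ∈ F → (a', b') ∈ F →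
      a = a' ∨ b = b') ∧ q * #E ≤ #F * (q + 2 * Δ + q ^ 3) := by
  obtain ⟨F, hF, hmax⟩ := exists_max_image
    (E.powerset.filter fun F : Finset (α × β) => (∀ a a' b b', (a, b) ∈ F → (a, b') ∈ F → (a', b) ∈ F →
      (a', b') ∈ F → a = a' ∨ b = b') ∧ (∀ x, #{p ∈ F | p.1 = x} ≤ q) ∧
      ∀ y, #{p ∈ F | p.2 = y} ≤ q) card ⟨∅, by simp⟩
  simp only [mem_filter, mem_powerset] at hF hmax
  obtain ⟨hFE, hC4, hd₁, hd₂⟩ := hF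
  refine ⟨F, hFE, hC4, ?_⟩
  set S₁ : Finset α := {x ∈ E.image Prod.fst | q ≤ #{p ∈ F | p.1 = x}} with hS₁
  set S₂ : Finset β := {y ∈ E.image Prod.snd | q ≤ #{p ∈ F | p.2 = y}} with hS₂
  -- The pairs that would close a 4-cycle opposite to `f`: the end edges of the path are the edges
  -- of `F` at the two ends of `f`.
  set Q : α × β → Finset (α × β) := fun f =>
    ({g ∈ F | g.2 = f.2}.image Prod.fst) ×ˢ ({g ∈ F | g.1 = f.1}.image Prod.snd) with hQ
  have hcover : E ⊆ F ∪ ({p ∈ E | p.1 ∈ S₁} ∪ ({p ∈ E | p.2 ∈ S₂} ∪ F.biUnion Q)) := by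
    rintro ⟨x, y⟩ hxy
    by_contra hcon
    simp only [mem_union, not_or, mem_filter, not_and, mem_biUnion, not_exists] at hcon
    obtain ⟨hnF, hn₁, hn₂, hnQ⟩ := hcon
    have hx : #{p ∈ F | p.1 = x} < q := by
      by_contra! h
      exact hn₁ hxy (mem_filter.2 ⟨mem_image_of_mem _ hxy, h⟩)
    have hy : #{p ∈ F | p.2 = y} < q := by
      by_contra! h
      exact hn₂ hxy (mem_filter.2 ⟨mem_image_of_mem _ hxy, h⟩)
    have hpath : ∀ x' y', (x, y') ∈ F → (x', y') ∈ F → (x', y) ∈ F → False := by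
      intro x' y' h1 h2 h3
      refine hnQ _ h2 (mem_product.2 ⟨mem_image.2 ⟨(x, y'), ?_, rfl⟩,
        mem_image.2 ⟨(x', y), ?_, rfl⟩⟩) <;> simp [h1, h3]
    have := hmax (insert (x, y) F) ⟨insert_subset hxy hFE, ?_, ?_, ?_⟩
    · rw [card_insert_of_notMem hnF] at this
      omega
    · intro a a' b b' h1 h2 h3 h4
      by_contra! hne
      simp only [mem_insert, Prod.mk.injEq] at h1 h2 h3 h4
      -- Wherever the new edge sits in the 4-cycle, the other three edges form a path in `F` between
      -- its ends.
      rcases h1 with ⟨rfl, rfl⟩ | h1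
      · have h2 := h2.resolve_left fun h => hne.2 h.2.symm
        have h3 := h3.resolve_left fun h => hne.1 h.1.symm
        have h4 := h4.resolve_left fun h => hne.1 h.1.symm
        exact hpath _ _ h2 h4 h3
      rcases h2 with ⟨rfl, rfl⟩ | h2
      · have h3 := h3.resolve_left fun h => hne.1 h.1.symm
        have h4 := h4.resolve_left fun h => hne.1 h.1.symm
        exact hpath _ _ h1 h3 h4
      rcases h3 with ⟨rfl, rfl⟩ | h3
      · have h4 := h4.resolve_left fun h => hne.2 h.2.symm
        exact hpath _ _ h4 h2 h1
      rcases h4 with ⟨rfl, rfl⟩ | h4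
      · exact hpath _ _ h3 h1 h2
      · exact (hC4 _ _ _ _ h1 h2 h3 h4).elim hne.1 hne.2
    · intro x'
      rw [filter_insert]
      split_ifs with h
      · obtain rfl : x = x' := h
        exact (card_insert_le _ _).trans hx
      · exact hd₁ x'
    · intro y'
      rw [filter_insert]
      split_ifs with h
      · obtain rfl : y = y' := h
        exact (card_insert_le _ _).trans hy
      · exact hd₂ y'
  have hc₁ : #{p ∈ E | p.1 ∈ S₁} ≤ Δ * #S₁ :=
    card_le_mul_card_image_of_maps_to (f := Prod.fst) (fun p hp => (mem_filter.1 hp).2) _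
      fun x _ => (card_le_card (filter_subset_filter _ (filter_subset _ _))).trans (h₁ x)
  have hc₂ : #{p ∈ E | p.2 ∈ S₂} ≤ Δ * #S₂ :=
    card_le_mul_card_image_of_maps_to (f := Prod.snd) (fun p hp => (mem_filter.1 hp).2) _
      fun x _ => (card_le_card (filter_subset_filter _ (filter_subset _ _))).trans (h₂ x)
  have hs₁ : q * #S₁ ≤ #F := by
    refine (mul_card_image_le_card_of_maps_to (s := {p ∈ F | p.1 ∈ S₁}) (f := Prod.fst)
      (fun p hp => (mem_filter.1 hp).2) q fun x hx => (mem_filter.1 hx).2.trans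
        (card_le_card fun p hp => ?_)).trans (card_le_card (filter_subset _ _))
    obtain ⟨hpF, rfl⟩ := mem_filter.1 hp
    simp [hpF, hx]
  have hs₂ : q * #S₂ ≤ #F := by
    refine (mul_card_image_le_card_of_maps_to (s := {p ∈ F | p.2 ∈ S₂}) (f := Prod.snd)
      (fun p hp => (mem_filter.1 hp).2) q fun x hx => (mem_filter.1 hx).2.trans
        (card_le_card fun p hp => ?_)).trans (card_le_card (filter_subset _ _))
    obtain ⟨hpF, rfl⟩ := mem_filter.1 hp
    simp [hpF, hx]
  have hcQ : #(F.biUnion Q) ≤ #F * (q * q) := by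
    refine card_biUnion_le_card_mul _ _ _ fun f _ => ?_
    rw [hQ, card_product]
    exact Nat.mul_le_mul (card_image_le.trans (hd₂ _)) (card_image_le.trans (hd₁ _))
  have hE : #E ≤ #F + (Δ * #S₁ + (Δ * #S₂ + #F * (q * q))) :=
    (card_le_card hcover).trans <| (card_union_le _ _).trans <| Nat.add_le_add_left
      ((card_union_le _ _).trans <| Nat.add_le_add hc₁ <|
        (card_union_le _ _).trans <| Nat.add_le_add hc₂ hcQ) _
  calc q * #E ≤ q * (#F + (Δ * #S₁ + (Δ * #S₂ + #F * (q * q)))) := Nat.mul_le_mul_left _ hE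
    _ = q * #F + Δ * (q * #S₁) + Δ * (q * #S₂) + #F * q ^ 3 := by ring
    _ ≤ q * #F + Δ * #F + Δ * #F + #F * q ^ 3 := by gcongr
    _ = _ := by ring

/-! ### Edge counts, cuts and the densest subgraph -/

namespace SimpleGraph

variable {V : Type*} (G : SimpleGraph V)

/-- The number of ordered adjacent pairs in `s × t`. -/
noncomputable def adjCount (s t : Finset V) : ℕ := ∑ x ∈ s, #{y ∈ t | G.Adj x y}

theorem adjCount_union_left {s s' : Finset V} (h : Disjoint s s') (t : Finset V) :
    G.adjCount (s ∪ s') t = G.adjCount s t + G.adjCount s' t := sum_union h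

theorem adjCount_comm (s t : Finset V) : G.adjCount s t = G.adjCount t s := by
  simp only [adjCount, card_filter]
  rw [sum_comm]
  simp only [G.adj_comm]

theorem adjCount_union_right (s : Finset V) {t t' : Finset V} (h : Disjoint t t') :
    G.adjCount s (t ∪ t') = G.adjCount s t + G.adjCount s t' := by
  rw [adjCount_comm, adjCount_union_left G h, adjCount_comm, G.adjCount_comm t']

theorem adjCount_union_self {s t : Finset V} (h : Disjoint s t) :
    G.adjCount (s ∪ t) (s ∪ t) = G.adjCount s s + 2 * G.adjCount s t + G.adjCount t t := by
  rw [adjCount_union_left G h, adjCount_union_right G _ h, adjCount_union_right G _ h,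
    G.adjCount_comm t s]
  ring

/-- Every graph has a cut containing half of its edges. -/
theorem exists_cut (R : Finset V) :
    ∃ X Y, Disjoint X Y ∧ X ∪ Y = R ∧ G.adjCount R R ≤ 4 * G.adjCount X Y := by
  induction R using Finset.induction_on with
  | empty => exact ⟨∅, ∅, by simp, by simp, by simp [adjCount]⟩
  | insert v R hv ih =>
    obtain ⟨X, Y, hXY, rfl, hcut⟩ := ih
    have hvX : v ∉ X := fun h => hv (mem_union_left _ h)
    have hvY : v ∉ Y := fun h => hv (mem_union_right _ h)
    have hvv : G.adjCount {v} {v} = 0 := by simp [adjCount, filter_singleton]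
    have hnew : G.adjCount (insert v (X ∪ Y)) (insert v (X ∪ Y)) =
        2 * (G.adjCount {v} X + G.adjCount {v} Y) + G.adjCount (X ∪ Y) (X ∪ Y) := by
      rw [insert_eq, adjCount_union_self G (disjoint_singleton_left.2 hv), hvv,
        adjCount_union_right G _ hXY]
      ring
    -- The new vertex joins the side where it has fewer neighbours.
    rcases le_total (G.adjCount {v} X) (G.adjCount {v} Y) with h | h
    · refine ⟨insert v X, Y, disjoint_insert_left.2 ⟨hvY, hXY⟩, insert_union _ _ _, ?_⟩
      rw [hnew, insert_eq, adjCount_union_left G (disjoint_singleton_left.2 hvX)]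
      omega
    · refine ⟨X, insert v Y, disjoint_insert_right.2 ⟨hvX, hXY⟩, union_insert _ _ _, ?_⟩
      rw [hnew, insert_eq, adjCount_union_right G _ (disjoint_singleton_left.2 hvY),
        G.adjCount_comm X {v}]
      omega

/-- Maximal density both limits the edges inside a small set and forces a set with many edges to be
large. -/
theorem exists_densest [Fintype V] [Nonempty V] : ∃ S : Finset V, S.Nonempty ∧
    ∀ T, G.adjCount T T ≤ (G.adjCount S S / #S : ℝ) * #T := by
  obtain ⟨S, hS, hmax⟩ := exists_max_image ({S : Finset V | S.Nonempty} : Finset (Finset V))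
    (fun S => (G.adjCount S S / #S : ℝ)) ⟨univ, by simp⟩
  refine ⟨S, (mem_filter.1 hS).2, fun T => ?_⟩
  rcases T.eq_empty_or_nonempty with rfl | hT
  · simp [adjCount]
  · have : (0 : ℝ) < #T := by exact_mod_cast hT.card_pos
    exact (div_le_iff₀ this).1 (hmax T (by simpa using hT))

theorem avgDegree_eq_adjCount [Fintype V] :
    G.avgDegree = G.adjCount univ univ / #(univ : Finset V) := by
  have h : 2 * G.edgeSet.ncard = G.adjCount univ univ := by
    rw [← coe_edgeFinset, Set.ncard_coe_finset, two_mul_card_edgeFinset, adjCount, card_filter,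
      ← univ_product_univ, sum_product]
    simp only [card_filter]
  rw [avgDegree, ← h, Nat.card_eq_fintype_card, card_univ]
  push_cast
  rfl

variable {G}

/-- The case of bounded maximum degree. -/
theorem hasC4FreeBipartite_of_degree_le {k K : ℕ} {R : Finset V} {D n : ℝ} (hk : 0 < k)
    (hK : 0 < K) (hD : ((32 * k * K : ℕ) : ℝ) ^ 3 ≤ D) (hn : 0 < n) (hRn : #R ≤ n)
    (hdeg : ∀ x ∈ R, (#{y ∈ R | G.Adj x y} : ℝ) ≤ K * D)
    (hR : D * n / 4 ≤ G.adjCount R R) : G.HasC4FreeBipartite k := by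
  obtain ⟨X, Y, hXY, rfl, hcut⟩ := G.exists_cut R
  -- As `D ≥ q ^ 3`, the bracket in `exists_C4Free_subset` is at most `4 * K * D`. With `D * n / 16`
  -- edges in the cut this gives `#F ≥ q * n / (64 * K) = k * n / 2`.
  set q := 32 * k * K with hq
  have hqpos : 0 < q := by positivity
  have hq1 : (1 : ℝ) ≤ q := by exact_mod_cast hqpos
  have hK1 : (1 : ℝ) ≤ K := by exact_mod_cast hK
  have hDpos : 0 < D := lt_of_lt_of_le (by positivity) hD
  have hdeg' : ∀ x ∈ X ∪ Y, #{y ∈ X ∪ Y | G.Adj x y} ≤ ⌊(K : ℝ) * D⌋₊ := fun x hx =>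
    Nat.le_floor (hdeg x hx)
  obtain ⟨F, hFE, hC4, hF⟩ := exists_C4Free_subset {p ∈ X ×ˢ Y | G.Adj p.1 p.2} ⌊(K : ℝ) * D⌋₊ q
    (by
      intro x
      by_cases hx : x ∈ X
      · refine le_trans ?_ (hdeg' x (mem_union_left _ hx))
        refine card_le_card_of_injOn Prod.snd ?_ ?_
        · rintro ⟨a, b⟩ h
          simp only [coe_filter, mem_filter, mem_product, Set.mem_ofPred_eq] at h
          obtain ⟨⟨⟨-, hb⟩, hab⟩, rfl⟩ := h
          simp [hb, hab]
        · rintro ⟨a, b⟩ h ⟨a', b'⟩ h' hbb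
          simp only [coe_filter, mem_filter, Set.mem_ofPred_eq] at h h' hbb
          rw [h.2, h'.2, hbb]
      · rw [card_eq_zero.2]
        · exact Nat.zero_le _
        · refine filter_eq_empty_iff.2 ?_
          rintro ⟨a, b⟩ h rfl
          exact hx (mem_product.1 (mem_filter.1 h).1).1)
    (by
      intro y
      by_cases hy : y ∈ Y
      · refine le_trans ?_ (hdeg' y (mem_union_right _ hy))
        refine card_le_card_of_injOn Prod.fst ?_ ?_
        · rintro ⟨a, b⟩ h
          simp only [coe_filter, mem_filter, mem_product, Set.mem_ofPred_eq] at h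
          obtain ⟨⟨⟨ha, -⟩, hab⟩, rfl⟩ := h
          simp [ha, hab.symm]
        · rintro ⟨a, b⟩ h ⟨a', b'⟩ h' hbb
          simp only [coe_filter, mem_filter, Set.mem_ofPred_eq] at h h' hbb
          rw [h.2, h'.2, hbb]
      · rw [card_eq_zero.2]
        · exact Nat.zero_le _
        · refine filter_eq_empty_iff.2 ?_
          rintro ⟨a, b⟩ h rfl
          exact hy (mem_product.1 (mem_filter.1 h).1).2)
  have hE : #{p ∈ X ×ˢ Y | G.Adj p.1 p.2} = G.adjCount X Y := by
    rw [card_filter, sum_product, adjCount]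
    simp only [card_filter]
  rw [hE] at hF
  refine ⟨X, Y, F, ?_, hXY, ?_, hC4, ?_⟩
  · rw [nonempty_iff_ne_empty]
    intro h
    rw [h] at hR
    simp only [adjCount, sum_empty, Nat.cast_zero] at hR
    have : 0 < D * n := by positivity
    linarith
  · intro a b h
    have := hFE h
    simp only [mem_filter, mem_product] at this
    exact ⟨this.1.1, this.1.2, this.2⟩
  · have hΔ : ((⌊(K : ℝ) * D⌋₊ : ℕ) : ℝ) ≤ K * D := Nat.floor_le (by positivity)
    have hF' : (q : ℝ) * G.adjCount X Y ≤ #F * (q + 2 * ⌊(K : ℝ) * D⌋₊ + q ^ 3) := by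
      exact_mod_cast hF
    have hcut' : (G.adjCount (X ∪ Y) (X ∪ Y) : ℝ) ≤ 4 * G.adjCount X Y := by exact_mod_cast hcut
    have hq3 : (q : ℝ) ≤ q ^ 3 := le_self_pow₀ hq1 (by norm_num)
    have hDK : D ≤ K * D := le_mul_of_one_le_left hDpos.le hK1
    have h1 : (q : ℝ) * (D * n / 16) ≤ #F * (4 * (K * D)) :=
      calc (q : ℝ) * (D * n / 16) ≤ q * G.adjCount X Y := by gcongr; linarith
        _ ≤ _ := hF'
        _ ≤ _ := by gcongr; linarith
    have hqc : (q : ℝ) = 32 * k * K := by rw [hq]; push_cast; ring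
    have h2 : (k * n) * (2 * (K * D)) ≤ (2 * #F) * (2 * (K * D)) := by
      rw [hqc] at h1
      linarith
    have h3 : k * n ≤ 2 * #F := le_of_mul_le_mul_right h2 (by positivity)
    have h4 : (k : ℝ) * (#X + #Y : ℕ) ≤ k * n := by
      rw [← card_union_of_disjoint hXY]
      gcongr
    exact_mod_cast h4.trans h3

theorem hasC4FreeBipartite_of_densest {k p : ℕ} [Fact p.Prime] (hk : 0 < k) (hkp : k ≤ p)
    {S : Finset V} {D : ℝ} (hS : S.Nonempty) (hD : D * #S = G.adjCount S S)
    (hT : ∀ T, G.adjCount T T ≤ D * #T) (h1 : ((8 * k ^ p ^ 2 : ℕ) : ℝ) ≤ D)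
    (h2 : ((32 * k * (4 * (imbalance k (p ^ 2) (p ^ 2) + 1)) : ℕ) : ℝ) ^ 3 ≤ D) :
    G.HasC4FreeBipartite k := by
  have hppos : 0 < p := (Fact.out : p.Prime).pos
  set M := imbalance k (p ^ 2) (p ^ 2) with hM
  have hMpos : 0 < M := imbalance_pos hk (by positivity) _
  have hDpos : 0 < D := lt_of_lt_of_le (by positivity) h1
  have hSpos : (0 : ℝ) < #S := by exact_mod_cast hS.card_pos
  -- Chosen so that `K * #L ≤ #S ≤ 4 * (#L + #B)` yields `M * #L ≤ #B`.
  set K := 4 * (M + 1) with hK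
  have hK4 : (4 : ℝ) ≤ K := by rw [hK]; exact_mod_cast (by omega)
  set L : Finset V := {x ∈ S | (K : ℝ) * D < #{y ∈ S | G.Adj x y}} with hL
  have hLS : L ⊆ S := filter_subset _ _
  have hunion : L ∪ (S \ L) = S := union_sdiff_of_subset hLS
  have hdisj : Disjoint L (S \ L) := disjoint_sdiff
  have hKL : (K : ℝ) * #L ≤ #S := by
    have h3 : (K * D) * #L ≤ D * #S := by
      rw [hD]
      calc (K * D) * #L = ∑ x ∈ L, (K : ℝ) * D := by simp [mul_comm]
        _ ≤ ∑ x ∈ L, (#{y ∈ S | G.Adj x y} : ℝ) :=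
          sum_le_sum fun x hx => (mem_filter.1 hx).2.le
        _ ≤ ∑ x ∈ S, (#{y ∈ S | G.Adj x y} : ℝ) :=
          sum_le_sum_of_subset_of_nonneg hLS fun _ _ _ => by positivity
        _ = _ := by simp [adjCount]
    refine le_of_mul_le_mul_left ?_ hDpos
    linarith
  have hsplit := G.adjCount_union_self hdisj
  rw [hunion] at hsplit
  rcases le_or_gt (D * #S / 4) (G.adjCount (S \ L) (S \ L)) with hbal | hunbal
  · refine hasC4FreeBipartite_of_degree_le hk (by omega : 0 < K) h2 hSpos
      (by exact_mod_cast card_le_card sdiff_subset) ?_ hbal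
    intro x hx
    obtain ⟨hxS, hxL⟩ := mem_sdiff.1 hx
    have hx' : (#{y ∈ S | G.Adj x y} : ℝ) ≤ K * D := by
      by_contra! h
      exact hxL (mem_filter.2 ⟨hxS, h⟩)
    refine le_trans ?_ hx'
    exact_mod_cast card_le_card (filter_subset_filter _ sdiff_subset)
  · have hLL := hT L
    have hsplit' : (G.adjCount S S : ℝ) = G.adjCount L L + 2 * G.adjCount L (S \ L) +
      G.adjCount (S \ L) (S \ L) := by exact_mod_cast hsplit
    have hLpos : (0 : ℝ) ≤ #L := by positivity
    have h4L : 4 * (#L : ℝ) ≤ #S := le_trans (by gcongr) hKL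
    have hDL : D * (4 * #L) ≤ D * #S := by gcongr
    have hcross : D * #S / 4 ≤ G.adjCount (S \ L) L := by
      rw [adjCount_comm]; linarith
    set B : Finset V := {b ∈ S \ L | k ^ p ^ 2 ≤ #{a ∈ L | G.Adj a b}} with hB
    have hdisjB : Disjoint L B := disjoint_of_subset_right (filter_subset _ _) hdisj
    have hBcross : D * #S / 8 ≤ G.adjCount L B := by
      -- A vertex outside `B` has fewer than `k ^ p ^ 2` neighbours in `L`, so the total loss is at
      -- most `D * #S / 8`.
      have h3 : G.adjCount (S \ L) L ≤ G.adjCount B L + k ^ p ^ 2 * #S := by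
        calc G.adjCount (S \ L) L
            ≤ ∑ b ∈ S \ L, ((if k ^ p ^ 2 ≤ #{a ∈ L | G.Adj a b} then
                #{a ∈ L | G.Adj b a} else 0) + k ^ p ^ 2) := by
              refine sum_le_sum fun b _ => ?_
              split_ifs with h
              · exact Nat.le_add_right _ _
              · simp only [G.adj_comm b]
                omega
          _ = G.adjCount B L + #(S \ L) * k ^ p ^ 2 := by
              rw [sum_add_distrib, ← sum_filter, sum_const, smul_eq_mul, adjCount]
          _ ≤ _ := by
              rw [mul_comm]
              gcongr
              exact sdiff_subset
      have h4 : (G.adjCount (S \ L) L : ℝ) ≤ G.adjCount L B + (k ^ p ^ 2 : ℕ) * #S := by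
        rw [G.adjCount_comm L B]
        exact_mod_cast h3
      have h5 : ((8 * k ^ p ^ 2 : ℕ) : ℝ) * #S ≤ D * #S := by gcongr
      push_cast at h4 h5
      linarith
    have hLB : (G.adjCount (L ∪ B) (L ∪ B) : ℝ) ≤ D * (#L + #B) := by
      have := hT (L ∪ B)
      rw [card_union_of_disjoint hdisjB] at this
      exact_mod_cast this
    have hLB' : 2 * (G.adjCount L B : ℝ) ≤ G.adjCount (L ∪ B) (L ∪ B) := by
      rw [G.adjCount_union_self hdisjB]
      exact_mod_cast (by omega)
    -- `L ∪ B` has degree sum at least `D * #S / 4` but density at most `D`.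
    have hsum : (#S : ℝ) ≤ 4 * (#L + #B) := by
      refine le_of_mul_le_mul_left ?_ hDpos
      linarith
    have hsum' : K * #L ≤ 4 * (#L + #B) := by exact_mod_cast hKL.trans hsum
    have hcard : M * #L ≤ #B := by
      rw [hK] at hsum'
      linarith
    refine hasC4FreeBipartite_of_imbalance hk hkp hdisjB ?_ (fun b hb => (mem_filter.1 hb).2) hcard
    rw [← card_pos]
    by_contra h0
    have hB0 : #B = 0 := by omega
    have hL0 : #L = 0 := by
      rw [hB0] at hcard
      exact (Nat.mul_eq_zero.1 (Nat.le_zero.1 hcard)).resolve_left hMpos.ne'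
    rw [hB0, hL0] at hsum
    norm_num at hsum
    exact hS.ne_empty hsum

end SimpleGraph

/-! ### Numerical bounds and conclusion -/

theorem imbalance_le {k : ℕ} (hk : 2 ≤ k) (s j : ℕ) :
    imbalance k s j ≤ s * k ^ (j ^ 2 + 6 * j) := by
  induction j with
  | zero => simp [imbalance]
  | succ j ih =>
    have h6 : 6 ≤ k ^ 3 := le_trans (by norm_num) (Nat.pow_le_pow_left hk 3)
    calc imbalance k s (j + 1) = 6 * k ^ (2 * j + 4) * imbalance k s j := rfl
      _ ≤ k ^ 3 * k ^ (2 * j + 4) * (s * k ^ (j ^ 2 + 6 * j)) := by gcongr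
      _ = s * k ^ ((j + 1) ^ 2 + 6 * (j + 1)) := by ring

/-- With `p ≤ 2 * k` the exponent needed is only of order `k ^ 4`; the constant 200 and the power `k
^ 6` leave room. -/
theorem density_bound {k p : ℕ} (hk : 2 ≤ k) (hp : 0 < p) (hpk : p ≤ 2 * k) :
    8 * k ^ p ^ 2 ≤ k ^ (200 * k ^ 6) ∧
      (32 * k * (4 * (imbalance k (p ^ 2) (p ^ 2) + 1))) ^ 3 ≤ k ^ (200 * k ^ 6) := by
  have hk1 : 1 ≤ k := by omega
  have h8 : 8 ≤ k ^ 3 := Nat.pow_le_pow_left hk 3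
  have h32 : 32 ≤ k ^ 5 := Nat.pow_le_pow_left hk 5
  have hs : p ^ 2 ≤ 4 * k ^ 2 := by
    calc p ^ 2 ≤ (2 * k) ^ 2 := Nat.pow_le_pow_left hpk 2
      _ = _ := by ring
  have hs4 : p ^ 2 ≤ k ^ 4 := by
    calc p ^ 2 ≤ 2 ^ 2 * k ^ 2 := hs
      _ ≤ k ^ 2 * k ^ 2 := by gcongr
      _ = k ^ 4 := by ring
  have hk6 : 1 ≤ k ^ 6 := Nat.one_le_pow _ _ hk1
  have hk26 : k ^ 2 ≤ k ^ 6 := Nat.pow_le_pow_right hk1 (by norm_num)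
  have hk46 : k ^ 4 ≤ k ^ 6 := Nat.pow_le_pow_right hk1 (by norm_num)
  constructor
  · calc 8 * k ^ p ^ 2 ≤ k ^ 3 * k ^ p ^ 2 := by gcongr
      _ = k ^ (3 + p ^ 2) := by ring
      _ ≤ _ := Nat.pow_le_pow_right hk1 (by omega)
  · set M := imbalance k (p ^ 2) (p ^ 2) with hM
    have hMpos : 0 < M := imbalance_pos hk1 (by positivity) _
    have hMle : M ≤ k ^ 4 * k ^ ((p ^ 2) ^ 2 + 6 * p ^ 2) :=
      (imbalance_le hk _ _).trans (Nat.mul_le_mul_right _ hs4)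
    have hs2 : (p ^ 2) ^ 2 ≤ 16 * k ^ 4 := by
      calc (p ^ 2) ^ 2 ≤ (4 * k ^ 2) ^ 2 := Nat.pow_le_pow_left hs 2
        _ = _ := by ring
    calc (32 * k * (4 * (M + 1))) ^ 3 ≤ (32 * k * (8 * M)) ^ 3 :=
          Nat.pow_le_pow_left (Nat.mul_le_mul_left _ (by omega)) 3
      _ ≤ (k ^ 5 * k * (k ^ 3 * (k ^ 4 * k ^ ((p ^ 2) ^ 2 + 6 * p ^ 2)))) ^ 3 := by gcongr
      _ = k ^ (3 * (13 + (p ^ 2) ^ 2 + 6 * p ^ 2)) := by ring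
      _ ≤ _ := Nat.pow_le_pow_right hk1 (by omega)

theorem SimpleGraph.hasC4FreeBipartite_of_avgDegree {V : Type*} [Finite V] {G : SimpleGraph V}
    {k : ℕ} (h : (k : ℝ) ^ (200 * k ^ 6) ≤ G.avgDegree) : G.HasC4FreeBipartite k := by
  have := Fintype.ofFinite V
  have hpos : 0 < G.avgDegree := by
    refine lt_of_lt_of_le ?_ h
    rcases Nat.eq_zero_or_pos k with rfl | hk
    · simp
    · positivity
  have hne : Nonempty V := by
    by_contra hV
    rw [not_nonempty_iff] at hV
    -- On an empty vertex set division by zero makes the average degree 0.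
    simp [avgDegree] at hpos
  rcases Nat.lt_or_ge k 2 with hk | hk
  · obtain ⟨e, he⟩ : G.edgeSet.Nonempty := by
      rw [Set.nonempty_iff_ne_empty]
      intro h0
      simp [avgDegree, h0] at hpos
    induction e with | _ x y
    have hxy : G.Adj x y := he
    refine ⟨{x}, {y}, {(x, y)}, by simp, by simpa using hxy.ne, by simpa using hxy, ?_, ?_⟩
    · intro a a' b b' h1 _ h3 _
      simp only [mem_singleton, Prod.mk.injEq] at h1 h3
      exact Or.inl (h1.1.trans h3.1.symm)
    · simp only [card_singleton]
      omega
  · obtain ⟨p, hp, hkp, hpk⟩ := Nat.exists_prime_lt_and_le_two_mul k (by omega)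
    have : Fact p.Prime := ⟨hp⟩
    obtain ⟨S, hS, hmax⟩ := G.exists_densest
    have hSpos : (0 : ℝ) < #S := by exact_mod_cast hS.card_pos
    have hD : (k : ℝ) ^ (200 * k ^ 6) ≤ G.adjCount S S / #S := by
      refine h.trans ?_
      rw [avgDegree_eq_adjCount, div_le_iff₀ (by exact_mod_cast univ_nonempty.card_pos)]
      exact hmax univ
    obtain ⟨h1, h2⟩ := density_bound hk hp.pos hpk
    exact hasC4FreeBipartite_of_densest (by omega) hkp.le hS (div_mul_cancel₀ _ hSpos.ne') hmax
      (le_trans (by exact_mod_cast h1) hD) (le_trans (by exact_mod_cast h2) hD)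

end

theorem corollary1p2 :
    ∃ C : ℕ, ∀ (k : ℕ) (V : Type*) [Finite V] (G : SimpleGraph V),
      (k : ℝ) ^ (C * k ^ 6) ≤ G.avgDegree →
        ∃ H : G.Subgraph, H.verts.Nonempty ∧ H.coe.IsBipartite ∧
          (SimpleGraph.cycleGraph 4).Free H.coe ∧ (k : ℝ) ≤ H.coe.avgDegree :=
  ⟨200, fun _ _ _ _ h => (SimpleGraph.hasC4FreeBipartite_of_avgDegree h).exists_subgraph⟩
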